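/- Let $\mathbb{T} = \mathbb{R}/2\pi\mathbb{Z}$. Let $a<b$ be real numbers and let $\gamma \in C^0(\mathbb{T}, (a,b)\times\mathbb{T})$ be a closed path that is not homotopic, as a continuous map $\mathbb{T}\to(a,b)\times\mathbb{T}$, to a constant path. Then $\{a\}\times\mathbb{T}$ and $\{b\}\times\mathbb{T}$ are included in different connected components of $([a,b]\times\mathbb{T})\setminus\gamma(\mathbb{T})$. -/

import Mathlib

/-- The one-dimensional torus `ℝ / 2πℤ`. -/
abbrev Torus : Type := AddCircle (2 * Real.pi)

/-- The set `([a,b] × 𝕋) \ γ(𝕋)`, as a subset of `ℝ × 𝕋`, for a closed path `γ` in `(a,b) × 𝕋`. -/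
def loopComplement (a b : ℝ) (γ : C(Torus, Set.Ioo a b × Torus)) : Set (ℝ × Torus) :=
  (Set.Icc a b ×ˢ (Set.univ : Set Torus)) \ Set.range (fun t : Torus => (((γ t).1 : ℝ), (γ t).2))

/-! Map the cylinder into the punctured plane by `exp (s + iθ)` and let `f` be the image of `γ`. A
continuous logarithm of `f - w` expresses winding number zero about `w`, and this is locally
constant in `w` off the curve. It holds on the outer circle, as `|f| < |w|` there. If both boundary
circles lay in one component, it would pass to the inner circle and then, through the disc inside,
to `w = 0`. A logarithm of `f` lifts the angle of `γ` to `ℝ`, so `γ` would contract. -/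

/-- `f` is the exponential of a continuous function. -/
def HasContinuousLog {X : Type*} [TopologicalSpace X] (f : X → ℂ) : Prop :=
  ∃ h : X → ℂ, Continuous h ∧ ∀ t, f t = Complex.exp (h t)

/-- As in Rouché's theorem, `g / f` stays within distance `1` of `1`, where the principal logarithm
is continuous. -/
theorem HasContinuousLog.of_norm_sub_lt {X : Type*} [TopologicalSpace X] {f g : X → ℂ}
    (hf : HasContinuousLog f) (hg : Continuous g) (hfg : ∀ t, ‖g t - f t‖ < ‖f t‖) :
    HasContinuousLog g := by
  obtain ⟨h, hh, hfh⟩ := hf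
  have hne : ∀ t, f t ≠ 0 := fun t => by rw [hfh t]; exact Complex.exp_ne_zero _
  have hfc : Continuous f := by
    rw [show f = fun t => Complex.exp (h t) from funext hfh]
    fun_prop
  have hmem : ∀ t, g t / f t ∈ Complex.slitPlane := fun t => by
    have hlt : ‖(g t - f t) / f t‖ < 1 := by
      rw [norm_div, div_lt_one (norm_pos_iff.mpr (hne t))]
      exact hfg t
    have := Complex.mem_slitPlane_of_norm_lt_one hlt
    rwa [sub_div, div_self (hne t), add_sub_cancel] at this
  refine ⟨fun t => h t + Complex.log (g t / f t),
    hh.add ((hg.div hfc hne).clog hmem), fun t => ?_⟩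
  rw [Complex.exp_add, ← hfh t, Complex.exp_log (Complex.slitPlane_ne_zero (hmem t)),
    mul_div_cancel₀ _ (hne t)]

theorem hasContinuousLog_const {X : Type*} [TopologicalSpace X] {c : ℂ} (hc : c ≠ 0) :
    HasContinuousLog (fun _ : X => c) :=
  ⟨fun _ => Complex.log c, continuous_const, fun _ => (Complex.exp_log hc).symm⟩

/-- Existence of a continuous logarithm of `f - w` depends only on the connected component of `w`
in the complement of the range of `f`. -/
theorem HasContinuousLog.sub_const_of_isPreconnected {X : Type*} [TopologicalSpace X]
    [CompactSpace X] {f : X → ℂ} (hf : Continuous f) {s : Set ℂ} (hs : IsPreconnected s)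
    (hsf : Disjoint s (Set.range f)) {w z : ℂ} (hw : w ∈ s) (hz : z ∈ s)
    (hlog : HasContinuousLog fun t => f t - w) : HasContinuousLog fun t => f t - z := by
  refine hs.induction₂' (fun x y => (HasContinuousLog fun t => f t - x) →
    HasContinuousLog fun t => f t - y) (fun x hx => ?_)
    (fun _ _ _ _ _ _ hxy hyz hlx => hyz (hxy hlx)) hw hz hlog
  have hopen : IsOpen (Set.range f)ᶜ := (isCompact_range hf).isClosed.isOpen_compl
  obtain ⟨ε, hε, hball⟩ := Metric.isOpen_iff.mp hopen x (Set.disjoint_left.mp hsf hx)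
  have hdist : ∀ t, ε ≤ ‖f t - x‖ := fun t => by
    by_contra! hlt
    exact hball (mem_ball_iff_norm.mpr hlt) ⟨t, rfl⟩
  -- Half of `ε` serves both directions: `‖f t - y‖` still exceeds `ε / 2`.
  filter_upwards [mem_nhdsWithin_of_mem_nhds (Metric.ball_mem_nhds x (half_pos hε))] with y hy
  rw [mem_ball_iff_norm] at hy
  constructor
  · refine fun hl => hl.of_norm_sub_lt (hf.sub continuous_const) fun t => ?_
    rw [sub_sub_sub_cancel_left, norm_sub_rev]
    linarith [hdist t]
  · refine fun hl => hl.of_norm_sub_lt (hf.sub continuous_const) fun t => ?_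
    rw [sub_sub_sub_cancel_left]
    have := norm_sub_le_norm_sub_add_norm_sub (f t) y x
    linarith [hdist t]

/-- The embedding `(s, θ) ↦ exp (s + iθ)` of the cylinder into the punctured plane. -/
noncomputable def cylinderExp (x : ℝ × Torus) : ℂ :=
  (Real.exp x.1 : ℂ) * (AddCircle.toCircle x.2 : ℂ)

theorem continuous_cylinderExp : Continuous cylinderExp := by
  unfold cylinderExp
  have := AddCircle.continuous_toCircle (T := 2 * Real.pi)
  fun_prop

theorem norm_cylinderExp (x : ℝ × Torus) : ‖cylinderExp x‖ = Real.exp x.1 := by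
  rw [cylinderExp, norm_mul, Circle.norm_coe, mul_one, Complex.norm_real, Real.norm_eq_abs,
    Real.abs_exp]

theorem cylinderExp_coe (s θ : ℝ) :
    cylinderExp (s, (θ : Torus)) = Complex.exp (s + θ * Complex.I) := by
  rw [cylinderExp, AddCircle.toCircle_apply_mk, div_self (by positivity), one_mul, Circle.coe_exp,
    Complex.ofReal_exp, Complex.exp_add]

theorem cylinderExp_injective : Function.Injective cylinderExp := by
  intro x y h
  have h1 : x.1 = y.1 := Real.exp_injective (by rw [← norm_cylinderExp, ← norm_cylinderExp, h])
  refine Prod.ext h1 ?_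
  rw [cylinderExp, cylinderExp, h1] at h
  have h2 := mul_left_cancel₀ (Complex.ofReal_ne_zero.mpr (Real.exp_pos _).ne') h
  exact AddCircle.injective_toCircle (by positivity) (Circle.ext h2)

/-- The imaginary part of the logarithm is a real lift of the angle; scale it to `0` while the
height slides to the midpoint. -/
theorem nullhomotopic_of_hasContinuousLog {X : Type*} [TopologicalSpace X] {a b : ℝ} (hab : a < b)
    (γ : C(X, Set.Ioo a b × Torus))
    (hlog : HasContinuousLog fun t => cylinderExp (((γ t).1 : ℝ), (γ t).2)) :
    γ.Nullhomotopic := by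
  obtain ⟨h, hh, hγh⟩ := hlog
  have hsplit : ∀ t, (((γ t).1 : ℝ), (γ t).2) = ((h t).re, ((h t).im : Torus)) := fun t => by
    apply cylinderExp_injective
    exact (hγh t).trans (by rw [cylinderExp_coe, Complex.re_add_im])
  have hmem : ∀ p : unitInterval × X,
      (1 - (p.1 : ℝ)) • ((γ p.2).1 : ℝ) + (p.1 : ℝ) • ((a + b) / 2) ∈ Set.Ioo a b := fun p =>
    convex_Ioo a b (γ p.2).1.2 ⟨by linarith, by linarith⟩
      (sub_nonneg.mpr p.1.2.2) p.1.2.1 (sub_add_cancel _ _)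
  refine ⟨(⟨(a + b) / 2, by linarith, by linarith⟩, 0), ⟨⟨⟨fun p =>
    (⟨_, hmem p⟩, (((1 - (p.1 : ℝ)) * (h p.2).im : ℝ) : Torus)), ?_⟩, fun t => ?_, fun t => ?_⟩⟩⟩
  · refine Continuous.prodMk (Continuous.subtype_mk (by fun_prop) _) ?_
    exact (AddCircle.continuous_mk' _).comp (by fun_prop)
  · refine Prod.ext (Subtype.ext ?_) ?_
    · simp
    · simpa using (congrArg Prod.snd (hsplit t)).symm
  · refine Prod.ext (Subtype.ext ?_) ?_ <;> simp

theorem singleton_prod_univ_subset_loopComplement {a b c : ℝ} (γ : C(Torus, Set.Ioo a b × Torus))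
    (hc : c ∈ Set.Icc a b \ Set.Ioo a b) :
    ({c} : Set ℝ) ×ˢ (Set.univ : Set Torus) ⊆ loopComplement a b γ := by
  rintro ⟨_, θ⟩ ⟨rfl, -⟩
  refine ⟨⟨hc.1, trivial⟩, ?_⟩
  rintro ⟨t, ht⟩
  exact hc.2 (congrArg Prod.fst ht ▸ (γ t).1.2)

theorem propositionB2 (a b : ℝ) (hab : a < b) (γ : C(Torus, Set.Ioo a b × Torus))
    (hγ : ¬ γ.Nullhomotopic) :
    ∃ p ∈ loopComplement a b γ, ∃ q ∈ loopComplement a b γ,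
      ({a} : Set ℝ) ×ˢ (Set.univ : Set Torus) ⊆ connectedComponentIn (loopComplement a b γ) p ∧
      ({b} : Set ℝ) ×ˢ (Set.univ : Set Torus) ⊆ connectedComponentIn (loopComplement a b γ) q ∧
      connectedComponentIn (loopComplement a b γ) p ≠
        connectedComponentIn (loopComplement a b γ) q := by
  have hsub_a := singleton_prod_univ_subset_loopComplement γ (c := a) (by simp [hab.le])
  have hsub_b := singleton_prod_univ_subset_loopComplement γ (c := b) (by simp [hab.le])
  have hconn (c : ℝ) : IsPreconnected (({c} : Set ℝ) ×ˢ (Set.univ : Set Torus)) :=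
    isPreconnected_singleton.prod isPreconnected_univ
  have hp : (a, (0 : Torus)) ∈ ({a} : Set ℝ) ×ˢ (Set.univ : Set Torus) := ⟨rfl, trivial⟩
  have hq : (b, (0 : Torus)) ∈ ({b} : Set ℝ) ×ˢ (Set.univ : Set Torus) := ⟨rfl, trivial⟩
  refine ⟨_, hsub_a hp, _, hsub_b hq, (hconn a).subset_connectedComponentIn hp hsub_a,
    (hconn b).subset_connectedComponentIn hq hsub_b, fun heq => hγ ?_⟩
  apply nullhomotopic_of_hasContinuousLog hab
  set f : Torus → ℂ := fun t => cylinderExp (((γ t).1 : ℝ), (γ t).2) with hf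
  have hfc : Continuous f := continuous_cylinderExp.comp (by fun_prop)
  set C := connectedComponentIn (loopComplement a b γ) (a, 0) with hC
  have hdisj : Disjoint (cylinderExp '' C) (Set.range f) := by
    rw [Set.disjoint_left]
    rintro _ ⟨x, hx, rfl⟩ ⟨t, ht⟩
    exact (connectedComponentIn_subset _ _ hx).2 ⟨t, cylinderExp_injective ht⟩
  have hlog_b : HasContinuousLog fun t => f t - cylinderExp (b, 0) := by
    have hne : -cylinderExp (b, 0) ≠ 0 := by
      rw [neg_ne_zero, ← norm_pos_iff, norm_cylinderExp]
      positivity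
    refine (hasContinuousLog_const hne).of_norm_sub_lt (hfc.sub continuous_const) fun t => ?_
    rw [sub_neg_eq_add, sub_add_cancel, norm_neg, hf, norm_cylinderExp, norm_cylinderExp]
    exact Real.exp_lt_exp.mpr (γ t).1.2.2
  have : Fact (0 < 2 * Real.pi) := ⟨Real.two_pi_pos⟩
  have hlog_a : HasContinuousLog fun t => f t - cylinderExp (a, 0) :=
    hlog_b.sub_const_of_isPreconnected hfc
      (isPreconnected_connectedComponentIn.image _ continuous_cylinderExp.continuousOn) hdisj
      (Set.mem_image_of_mem _ (heq.symm ▸ mem_connectedComponentIn (hsub_b hq) : (b, 0) ∈ C))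
      (Set.mem_image_of_mem _ (mem_connectedComponentIn (hsub_a hp)))
  -- This disc joins the inner circle to `0`, which is outside the image of the cylinder.
  have hball : Disjoint (Metric.closedBall (0 : ℂ) (Real.exp a)) (Set.range f) := by
    rw [Set.disjoint_left]
    rintro _ hx ⟨t, rfl⟩
    rw [mem_closedBall_zero_iff, hf, norm_cylinderExp, Real.exp_le_exp] at hx
    exact hx.not_gt (γ t).1.2.1
  simpa using hlog_a.sub_const_of_isPreconnected hfc (convex_closedBall 0 _).isPreconnected hball
    (mem_closedBall_zero_iff.mpr (norm_cylinderExp _).le)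
    (Metric.mem_closedBall_self (Real.exp_pos a).le)
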